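/- Let $N\ge 2$, $1<p<N$, and let $\Omega\subset\mathbb{R}^N$ be a bounded open set. Let $a:\Omega\times\mathbb{R}\times\mathbb{R}^N\to\mathbb{R}^N$ be a Carathéodory function such that $$a(x,s,\xi)\cdot\xi\ \ge\ b(s)|\xi|^p\qquad\text{for a.e. }x\in\Omega\text{ and all }s\in\mathbb{R},\ \xi\in\mathbb{R}^N,$$ where $b:\mathbb{R}\to\mathbb{R}$ is continuous and bounded and, for some $\alpha>0$ and $\theta\ge 0$, $b(s)\ge \alpha(1+|s|)^{-\theta(p-1)}$ for all $s\in\mathbb{R}$. Let $h:[0,\infty)\to[0,\infty]$ be continuous and finite on $(0,\infty)$, and suppose that there are $\gamma_2\ge 0$ and $c_2,s_2>0$ with $h(s)\le c_2 s^{-\gamma_2}$ for all $s\ge s_2$. Assume $$0\le\theta\le 1+\frac{\gamma_2}{p-1},$$ and let $0\le f\in L^m(\Omega)$ with $m>\frac Np$ ($m=\infty$ allowed). Then every entropy solution $u$ of $$-\operatorname{div}(a(x,u,\nabla u))=h(u)f\ \text{ in }\Omega,\qquad u\ge 0\ \text{ in }\Omega,\qquad u=0\ \text{ on }\partial\Omega,$$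 belongs to $L^\infty(\Omega)$. Here $T_k(s)=\max(-k,\min(s,k))$. An entropy solution is a nonnegative, measurable, a.e. finite function $u$ on $\Omega$ such that $T_k(u)\in W^{1,p}_0(\Omega)$ for every $k>0$ and such that, for every $k>0$ and every $\varphi\in W^{1,p}_0(\Omega)\cap L^\infty(\Omega)$, $$a(x,T_k(u),\nabla T_k(u))\in L^{\frac{p}{p-1}}(\Omega)^N,\qquad h(u)f\,T_k(u-\varphi)\in L^1(\Omega),$$ $$\int_\Omega a(x,u,\nabla u)\cdot\nabla T_k(u-\varphi)\,dx\ \le\ \int_\Omega h(u)f\,T_k(u-\varphi)\,dx .$$ In the last inequality $\nabla u$ denotes the (a.e. unique) measurable function $v:\Omega\to\mathbb{R}^N$ with $\nabla T_k(u)=v\,\chi_{\{|u|\le k\}}$ a.e. in $\Omega$ for every $k>0$. -/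

import Mathlib

open MeasureTheory Filter Topology
open scoped NNReal ENNReal ContDiff

noncomputable section

/-- Euclidean space `ℝ^N`. -/
abbrev RN (N : ℕ) : Type := EuclideanSpace ℝ (Fin N)

/-- The truncation `T_k(s) = max (-k, min (s, k))`. -/
def trunc (k s : ℝ) : ℝ := max (-k) (min s k)

/-- `φ ∈ C_c^∞(Ω)`. -/
def IsTestFunction {N : ℕ} (Ω : Set (RN N)) (φ : RN N → ℝ) : Prop :=
  ContDiff ℝ ∞ φ ∧ HasCompactSupport φ ∧ tsupport φ ⊆ Ω

/-- `G ∈ L^1_loc(Ω)^N` is a weak (distributional) gradient of `w ∈ L^1_loc(Ω)`: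
`∫_Ω w ∇φ = - ∫_Ω φ G` for all `φ ∈ C_c^∞(Ω)`. -/
structure HasWeakGradient {N : ℕ} (Ω : Set (RN N)) (w : RN N → ℝ) (G : RN N → RN N) : Prop where
  locInt : LocallyIntegrableOn w Ω
  grad_locInt : LocallyIntegrableOn G Ω
  integral_eq : ∀ φ : RN N → ℝ, IsTestFunction Ω φ →
    ∫ x in Ω, w x • gradient φ x = - ∫ x in Ω, φ x • G x

open Classical in
/-- The weak gradient of `w` on `Ω` (unique up to null sets; `0` if there is none). -/
def weakGradient {N : ℕ} (Ω : Set (RN N)) (w : RN N → ℝ) : RN N → RN N :=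
  if H : ∃ G, HasWeakGradient Ω w G then H.choose else 0

/-- `w ∈ W^{1,p}_0(Ω)`: `w ∈ W^{1,p}(Ω)`, and `w` is a limit in the norm of `W^{1,p}(Ω)` of
functions in `C_c^∞(Ω)`. -/
structure MemW01p {N : ℕ} (Ω : Set (RN N)) (p : ℝ) (w : RN N → ℝ) : Prop where
  memLp : MemLp w (ENNReal.ofReal p) (volume.restrict Ω)
  exists_grad : ∃ G, HasWeakGradient Ω w G
  grad_memLp : MemLp (weakGradient Ω w) (ENNReal.ofReal p) (volume.restrict Ω)
  approx : ∃ φ : ℕ → RN N → ℝ, (∀ n, IsTestFunction Ω (φ n)) ∧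
    Tendsto (fun n => eLpNorm (fun x => w x - φ n x) (ENNReal.ofReal p) (volume.restrict Ω))
      atTop (𝓝 0) ∧
    Tendsto (fun n => eLpNorm (fun x => weakGradient Ω w x - gradient (φ n) x)
      (ENNReal.ofReal p) (volume.restrict Ω)) atTop (𝓝 0)

/-- `v` is a generalized gradient of the measurable function `u` all of whose truncations are
in `W^{1,1}_loc(Ω)`: `∇ T_k(u) = v χ_{|u| ≤ k}` for every `k > 0`. -/
def IsGeneralizedGradient {N : ℕ} (Ω : Set (RN N)) (u : RN N → ℝ) (v : RN N → RN N) : Prop :=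
  AEMeasurable v (volume.restrict Ω) ∧
    ∀ k : ℝ, 0 < k →
      HasWeakGradient Ω (fun x => trunc k (u x)) ({x | |u x| ≤ k}.indicator v)

open Classical in
/-- The generalized gradient `∇u` (unique up to null sets; `0` if there is none). -/
def generalizedGradient {N : ℕ} (Ω : Set (RN N)) (u : RN N → ℝ) : RN N → RN N :=
  if H : ∃ v, IsGeneralizedGradient Ω u v then H.choose else 0

/-- `a : Ω × ℝ × ℝ^N → ℝ^N` is a Carathéodory function: measurable in `x` for every `(s, ξ)`,
continuous in `(s, ξ)` for almost every `x`. -/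
def IsCaratheodory {N : ℕ} (Ω : Set (RN N)) (a : RN N → ℝ → RN N → RN N) : Prop :=
  (∀ (s : ℝ) (ξ : RN N), AEMeasurable (fun x => a x s ξ) (volume.restrict Ω)) ∧
    ∀ᵐ x ∂(volume.restrict Ω), Continuous (fun q : ℝ × RN N => a x q.1 q.2)

/-- The right-hand side `h(u) f`, with values in `[0, ∞]` (and `∞ · 0 = 0`). -/
def source {N : ℕ} (h : ℝ≥0 → ℝ≥0∞) (f u : RN N → ℝ) (x : RN N) : ℝ≥0∞ :=
  h (u x).toNNReal * ENNReal.ofReal (f x)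

/-- `u` is an entropy solution to `- div (a(x, u, ∇u)) = h(u) f` in `Ω`, `u ≥ 0` in `Ω`,
`u = 0` on `∂Ω`. The fields `source_finite` and `source_integrable` together say that the
extended-real valued function `h(u) f T_k(u - φ)` is in `L^1(Ω)`. -/
structure IsEntropySolution {N : ℕ} (Ω : Set (RN N)) (p : ℝ) (a : RN N → ℝ → RN N → RN N)
    (h : ℝ≥0 → ℝ≥0∞) (f u : RN N → ℝ) : Prop where
  measurable : AEMeasurable u (volume.restrict Ω)
  nonneg : ∀ᵐ x ∂(volume.restrict Ω), 0 ≤ u x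
  trunc_mem : ∀ k : ℝ, 0 < k → MemW01p Ω p (fun x => trunc k (u x))
  flux_memLp : ∀ k : ℝ, 0 < k →
    MemLp (fun x => a x (trunc k (u x)) (weakGradient Ω (fun y => trunc k (u y)) x))
      (ENNReal.ofReal (p / (p - 1))) (volume.restrict Ω)
  source_finite : ∀ k : ℝ, 0 < k → ∀ φ : RN N → ℝ, MemW01p Ω p φ →
    MemLp φ ∞ (volume.restrict Ω) →
    ∀ᵐ x ∂(volume.restrict Ω),
      source h f u x * ENNReal.ofReal |trunc k (u x - φ x)| ≠ ⊤
  source_integrable : ∀ k : ℝ, 0 < k → ∀ φ : RN N → ℝ, MemW01p Ω p φ →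
    MemLp φ ∞ (volume.restrict Ω) →
    Integrable (fun x => (source h f u x).toReal * trunc k (u x - φ x)) (volume.restrict Ω)
  entropy_le : ∀ k : ℝ, 0 < k → ∀ φ : RN N → ℝ, MemW01p Ω p φ →
    MemLp φ ∞ (volume.restrict Ω) →
    ∫ x in Ω, inner ℝ (a x (u x) (generalizedGradient Ω u x))
        (weakGradient Ω (fun y => trunc k (u y - φ y)) x)
      ≤ ∫ x in Ω, (source h f u x).toReal * trunc k (u x - φ x)

end

/-! ### Gradients of smooth functions and test functions -/

/-! The proof is a Stampacchia iteration for `A(t) = |{u > t}|`, with increments of the level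
comparable to the level itself. Testing the entropy inequality with `φ = T_k(u)` only involves the
band `k < u ≤ k + j` on the left and `u > k` on the right. For `j ≤ k` and `k` large, the coercivity
is at least `α (3k)^{-θ(p-1)}` on the band and `h(u) ≤ c₂ k^{-γ₂}` above `k`. So the energy is at
most a constant times `k^{θ(p-1)-γ₂} j ∫_{u>k} f`, and the condition on `θ` turns the power of `k`
into at most `k^{p-1}` (`energy_level_le`).

Hölder, Sobolev (`exists_sobolev_const`) and Chebyshev then give `A(k+j) ≤ C (k/j)^κ A(k)^β`, where
`β > 1` because `m > N/p`. Only the ratio `k/j` enters, so the smallness required of `A(k₀)` does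
not depend on `k₀`. As `u` is finite a.e., `A` tends to `0`; a large `k₀` is small enough, and
iterating up to `2k₀` gives `A(2k₀) = 0` (`exists_eq_zero_of_level_le`).

The remaining work identifies the gradients. Since `u ≥ 0`, the function `T_j(u - T_k(u))` equals
`T_{k+j}(u) - T_k(u)`, a difference of elements of `W^{1,p}_0`. A chain rule is needed only to show
that the gradients of different truncations agree where both are inactive, so that they glue to `∇u`
(`exists_isGeneralizedGradient`). -/

lemma continuous_gradient {N : ℕ} {F : RN N → ℝ} (hF : ContDiff ℝ 1 F) :
    Continuous (gradient F) :=
  (InnerProductSpace.toDual ℝ (RN N)).symm.continuous.comp (hF.continuous_fderiv one_ne_zero)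

lemma norm_gradient {N : ℕ} (F : RN N → ℝ) (x : RN N) : ‖gradient F x‖ = ‖fderiv ℝ F x‖ := by
  simp [gradient]

lemma IsTestFunction.contDiff_one {N : ℕ} {Ω : Set (RN N)} {ψ : RN N → ℝ}
    (hψ : IsTestFunction Ω ψ) : ContDiff ℝ 1 ψ :=
  hψ.1.of_le (by exact_mod_cast le_top)

lemma IsTestFunction.continuous {N : ℕ} {Ω : Set (RN N)} {ψ : RN N → ℝ}
    (hψ : IsTestFunction Ω ψ) : Continuous ψ := hψ.1.continuous

lemma IsTestFunction.continuous_gradient {N : ℕ} {Ω : Set (RN N)} {ψ : RN N → ℝ}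
    (hψ : IsTestFunction Ω ψ) : Continuous (gradient ψ) :=
  _root_.continuous_gradient hψ.contDiff_one

lemma IsTestFunction.hasCompactSupport_gradient {N : ℕ} {Ω : Set (RN N)} {ψ : RN N → ℝ}
    (hψ : IsTestFunction Ω ψ) : HasCompactSupport (gradient ψ) :=
  (hψ.2.1.fderiv (𝕜 := ℝ)).comp_left (g := (InnerProductSpace.toDual ℝ (RN N)).symm) (map_zero _)

lemma IsTestFunction.eq_zero {N : ℕ} {Ω : Set (RN N)} {ψ : RN N → ℝ}
    (hψ : IsTestFunction Ω ψ) {x : RN N} (hx : x ∉ Ω) : ψ x = 0 :=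
  image_eq_zero_of_notMem_tsupport fun h => hx (hψ.2.2 h)

lemma IsTestFunction.gradient_eq_zero {N : ℕ} {Ω : Set (RN N)} {ψ : RN N → ℝ}
    (hψ : IsTestFunction Ω ψ) {x : RN N} (hx : x ∉ Ω) : gradient ψ x = 0 := by
  have : fderiv ℝ ψ x = 0 := by
    by_contra h
    exact hx (hψ.2.2 (support_fderiv_subset ℝ h))
  simp [gradient, this]

lemma IsTestFunction.exists_bound {N : ℕ} {Ω : Set (RN N)} {ψ : RN N → ℝ}
    (hψ : IsTestFunction Ω ψ) : ∃ M : ℝ, 0 ≤ M ∧ (∀ x, ‖ψ x‖ ≤ M) ∧ ∀ x, ‖gradient ψ x‖ ≤ M := by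
  obtain ⟨A, hA⟩ := hψ.2.1.exists_bound_of_continuous hψ.continuous
  obtain ⟨B, hB⟩ := hψ.hasCompactSupport_gradient.exists_bound_of_continuous hψ.continuous_gradient
  exact ⟨max A B, ((norm_nonneg _).trans (hA 0)).trans (le_max_left _ _),
    fun x => (hA x).trans (le_max_left _ _), fun x => (hB x).trans (le_max_right _ _)⟩

lemma IsTestFunction.sub {N : ℕ} {Ω : Set (RN N)} {φ ψ : RN N → ℝ}
    (hφ : IsTestFunction Ω φ) (hψ : IsTestFunction Ω ψ) :
    IsTestFunction Ω (fun x => φ x - ψ x) := by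
  refine ⟨hφ.1.sub hψ.1, hφ.2.1.sub hψ.2.1, ?_⟩
  exact (tsupport_sub φ ψ).trans (Set.union_subset hφ.2.2 hψ.2.2)

lemma IsTestFunction.gradient_sub {N : ℕ} {Ω : Set (RN N)} {φ ψ : RN N → ℝ}
    (hφ : IsTestFunction Ω φ) (hψ : IsTestFunction Ω ψ) (x : RN N) :
    gradient (fun x => φ x - ψ x) x = gradient φ x - gradient ψ x := by
  have h1 := (hφ.1.differentiable (by simp)) x
  have h2 := (hψ.1.differentiable (by simp)) x
  simp [gradient, fderiv_fun_sub h1 h2]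

/-- Integration by parts against a test function. -/
lemma integral_smul_gradient_eq_neg {N : ℕ} {Ω : Set (RN N)} {F ψ : RN N → ℝ}
    (hF : ContDiff ℝ 1 F) (hψ : IsTestFunction Ω ψ) :
    ∫ x, F x • gradient ψ x = - ∫ x, ψ x • gradient F x := by
  have hi1 : Integrable (fun x => F x • gradient ψ x) :=
    (hF.continuous.smul hψ.continuous_gradient).integrable_of_hasCompactSupport
      hψ.hasCompactSupport_gradient.smul_left
  have hi2 : Integrable (fun x => ψ x • gradient F x) :=
    (hψ.continuous.smul (continuous_gradient hF)).integrable_of_hasCompactSupport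
      hψ.2.1.smul_right
  have hi3 : Integrable (fun x => F x * ψ x) :=
    (hF.continuous.mul hψ.continuous).integrable_of_hasCompactSupport hψ.2.1.mul_left
  refine ext_inner_left ℝ fun e => ?_
  rw [inner_neg_right, ← integral_inner hi1, ← integral_inner hi2]
  have e1 : ∀ x, inner ℝ e (F x • gradient ψ x) = F x * fderiv ℝ ψ x e := fun x => by
    rw [inner_smul_right, inner_gradient_right]; rfl
  have e2 : ∀ x, inner ℝ e (ψ x • gradient F x) = fderiv ℝ F x e * ψ x := fun x => by
    rw [inner_smul_right, inner_gradient_right, mul_comm]; rfl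
  have hi1' := hi1.const_inner (𝕜 := ℝ) e
  have hi2' := hi2.const_inner (𝕜 := ℝ) e
  simp only [e1, e2] at hi1' hi2' ⊢
  exact integral_mul_fderiv_eq_neg_fderiv_mul_of_integrable hi2' hi1' hi3
    (fun x _ => hF.differentiable one_ne_zero x)
    (fun x _ => hψ.contDiff_one.differentiable one_ne_zero x)

/-! ### Weak gradients -/

lemma IsTestFunction.integrableOn_smul {N : ℕ} {Ω : Set (RN N)} {ψ : RN N → ℝ} {G : RN N → RN N}
    (hψ : IsTestFunction Ω ψ) (hG : LocallyIntegrableOn G Ω) :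
    Integrable (fun x => ψ x • G x) := by
  have h := (hG.integrableOn_compact_subset hψ.2.2 hψ.2.1).continuousOn_smul
    hψ.continuous.continuousOn hψ.2.1
  exact (integrableOn_iff_integrable_of_support_subset fun x hx => subset_tsupport ψ
    (fun h0 => hx (by simp [h0]))).1 h

/-- Fundamental lemma of the calculus of variations. It lets the chosen `weakGradient` be replaced
by any explicit candidate. -/
lemma HasWeakGradient.ae_eq {N : ℕ} {Ω : Set (RN N)} (hΩ : IsOpen Ω) {w w' : RN N → ℝ}
    {G G' : RN N → RN N} (h : HasWeakGradient Ω w G) (h' : HasWeakGradient Ω w' G')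
    (hw : w =ᵐ[volume.restrict Ω] w') : G =ᵐ[volume.restrict Ω] G' := by
  have key := hΩ.ae_eq_zero_of_integral_contDiff_smul_eq_zero
    (h.grad_locInt.sub h'.grad_locInt) (fun ψ h1 h2 h3 => by
      have hψ : IsTestFunction Ω ψ := ⟨h1, h2, h3⟩
      have i1 := hψ.integrableOn_smul h.grad_locInt
      have i2 := hψ.integrableOn_smul h'.grad_locInt
      have z : ∀ G : RN N → RN N, ∫ x, ψ x • G x = ∫ x in Ω, ψ x • G x := fun G =>
        (setIntegral_eq_integral_of_forall_compl_eq_zero fun x hx => by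
          simp [hψ.eq_zero hx]).symm
      simp only [Pi.sub_apply, smul_sub]
      rw [integral_sub i1 i2, z, z, sub_eq_zero, ← neg_inj, ← h.integral_eq ψ hψ,
        ← h'.integral_eq ψ hψ]
      refine integral_congr_ae ?_
      filter_upwards [hw] with x hx
      rw [hx])
  filter_upwards [(ae_restrict_iff' hΩ.measurableSet).2 key] with x hx
  exact sub_eq_zero.1 hx

lemma LocallyIntegrableOn.congr_ae_restrict {N : ℕ} {E : Type*} [NormedAddCommGroup E]
    {Ω : Set (RN N)} {f g : RN N → E} (hΩ : IsOpen Ω) (hf : LocallyIntegrableOn f Ω)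
    (h : f =ᵐ[volume.restrict Ω] g) : LocallyIntegrableOn g Ω := by
  rw [locallyIntegrableOn_iff hΩ.isLocallyClosed] at hf ⊢
  intro K hK hKc
  exact (hf K hK hKc).congr (ae_restrict_of_ae_restrict_of_subset hK h)

lemma HasWeakGradient.congr {N : ℕ} {Ω : Set (RN N)} (hΩ : IsOpen Ω) {w w' : RN N → ℝ}
    {G G' : RN N → RN N} (h : HasWeakGradient Ω w G)
    (hw : w =ᵐ[volume.restrict Ω] w') (hG : G =ᵐ[volume.restrict Ω] G') :
    HasWeakGradient Ω w' G' := by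
  refine ⟨LocallyIntegrableOn.congr_ae_restrict hΩ h.locInt hw,
    LocallyIntegrableOn.congr_ae_restrict hΩ h.grad_locInt hG, fun ψ hψ => ?_⟩
  have e1 : ∫ x in Ω, w' x • gradient ψ x = ∫ x in Ω, w x • gradient ψ x :=
    integral_congr_ae (hw.mono fun x hx => by simp only [hx])
  have e2 : ∫ x in Ω, ψ x • G' x = ∫ x in Ω, ψ x • G x :=
    integral_congr_ae (hG.mono fun x hx => by simp only [hx])
  rw [e1, e2, h.integral_eq ψ hψ]

lemma HasWeakGradient.sub {N : ℕ} {Ω : Set (RN N)} {w w' : RN N → ℝ}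
    {G G' : RN N → RN N} (h : HasWeakGradient Ω w G) (h' : HasWeakGradient Ω w' G') :
    HasWeakGradient Ω (fun x => w x - w' x) (fun x => G x - G' x) := by
  refine ⟨h.locInt.sub h'.locInt, h.grad_locInt.sub h'.grad_locInt, fun ψ hψ => ?_⟩
  have j : ∀ {w : RN N → ℝ}, LocallyIntegrableOn w Ω →
      Integrable (fun x => w x • gradient ψ x) (volume.restrict Ω) := fun {w} hw => by
    have h1 : IntegrableOn (fun x => w x • gradient ψ x) (tsupport ψ) :=
      (hw.integrableOn_compact_subset hψ.2.2 hψ.2.1).smul_continuousOn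
        hψ.continuous_gradient.continuousOn hψ.2.1
    refine ((integrableOn_iff_integrable_of_support_subset fun x hx => ?_).1 h1).restrict
    by_contra hx'
    apply hx
    have : fderiv ℝ ψ x = 0 := by
      by_contra h0
      exact hx' (support_fderiv_subset ℝ h0)
    simp [gradient, this]
  have i1 := j h.locInt
  have i2 := j h'.locInt
  have i3 := (hψ.integrableOn_smul h.grad_locInt).restrict (s := Ω)
  have i4 := (hψ.integrableOn_smul h'.grad_locInt).restrict (s := Ω)
  simp only [sub_smul, smul_sub]
  rw [integral_sub i1 i2, integral_sub i3 i4, h.integral_eq ψ hψ, h'.integral_eq ψ hψ]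
  abel

lemma hasWeakGradient_weakGradient {N : ℕ} {Ω : Set (RN N)} {w : RN N → ℝ}
    (h : ∃ G, HasWeakGradient Ω w G) : HasWeakGradient Ω w (weakGradient Ω w) := by
  rw [weakGradient, dif_pos h]
  exact h.choose_spec

/-! ### The chain rule for limits of test functions -/

/-- `w` and `G` are `L^p` limits of test functions and of their gradients. -/
def IsTestLimit {N : ℕ} (Ω : Set (RN N)) (q : ℝ≥0∞) (w : RN N → ℝ) (G : RN N → RN N) : Prop :=
  ∃ φ : ℕ → RN N → ℝ, (∀ n, IsTestFunction Ω (φ n)) ∧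
    Tendsto (fun n => eLpNorm (fun x => w x - φ n x) q (volume.restrict Ω)) atTop (𝓝 0) ∧
    Tendsto (fun n => eLpNorm (fun x => G x - gradient (φ n) x) q (volume.restrict Ω))
      atTop (𝓝 0)

lemma tendsto_eLpNorm_of_exponent_le {α E : Type*} [MeasurableSpace α] [NormedAddCommGroup E]
    {μ : Measure α} [IsFiniteMeasure μ] {q r : ℝ≥0∞} (hq : q ≠ 0) (hqr : q ≤ r)
    {f : ℕ → α → E} (hf : ∀ n, AEStronglyMeasurable (f n) μ)
    (h : Tendsto (fun n => eLpNorm (f n) r μ) atTop (𝓝 0)) :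
    Tendsto (fun n => eLpNorm (f n) q μ) atTop (𝓝 0) := by
  have h2 : Tendsto (fun n => eLpNorm (f n) r μ * μ Set.univ ^ (1 / q.toReal - 1 / r.toReal))
      atTop (𝓝 0) := by
    have h0 : (0 : ℝ≥0∞) = 0 * μ Set.univ ^ (1 / q.toReal - 1 / r.toReal) := by simp
    rw [h0]
    refine ENNReal.Tendsto.mul_const h (Or.inr (ENNReal.rpow_ne_top_of_nonneg ?_
      (measure_ne_top _ _)))
    rcases eq_or_ne r ∞ with rfl | hr
    · simp
    · rw [sub_nonneg]
      exact one_div_le_one_div_of_le (ENNReal.toReal_pos hq (ne_top_of_le_ne_top hr hqr))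
        (ENNReal.toReal_mono hr hqr)
  exact tendsto_of_tendsto_of_tendsto_of_le_of_le tendsto_const_nhds h2 (fun _ => zero_le)
    fun n => eLpNorm_le_eLpNorm_mul_rpow_measure_univ hqr (hf n)

lemma IsTestLimit.mono_exponent {N : ℕ} {Ω : Set (RN N)} [IsFiniteMeasure (volume.restrict Ω)]
    {q r : ℝ≥0∞} (hq : q ≠ 0) (hqr : q ≤ r) {w : RN N → ℝ} {G : RN N → RN N}
    (hw : AEStronglyMeasurable w (volume.restrict Ω))
    (hG : AEStronglyMeasurable G (volume.restrict Ω))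
    (h : IsTestLimit Ω r w G) : IsTestLimit Ω q w G := by
  obtain ⟨φ, hφ, h1, h2⟩ := h
  exact ⟨φ, hφ,
    tendsto_eLpNorm_of_exponent_le hq hqr
      (fun n => hw.sub (hφ n).continuous.aestronglyMeasurable) h1,
    tendsto_eLpNorm_of_exponent_le hq hqr
      (fun n => hG.sub (hφ n).continuous_gradient.aestronglyMeasurable) h2⟩

/-- Norm convergence gives convergence in measure, hence an a.e. convergent subsequence. Pointwise
limits serve the nonlinear term of the chain rule and Fatou's lemma in the Sobolev inequality. -/
lemma IsTestLimit.exists_tendsto_ae {N : ℕ} {Ω : Set (RN N)} {q : ℝ≥0∞} (hq : q ≠ 0)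
    {w : RN N → ℝ} {G : RN N → RN N} (hw : AEStronglyMeasurable w (volume.restrict Ω))
    (h : IsTestLimit Ω q w G) : ∃ φ : ℕ → RN N → ℝ, (∀ n, IsTestFunction Ω (φ n)) ∧
    Tendsto (fun n => eLpNorm (fun x => w x - φ n x) q (volume.restrict Ω)) atTop (𝓝 0) ∧
    Tendsto (fun n => eLpNorm (fun x => G x - gradient (φ n) x) q (volume.restrict Ω))
      atTop (𝓝 0) ∧
    ∀ᵐ x ∂(volume.restrict Ω), Tendsto (fun n => φ n x) atTop (𝓝 (w x)) := by
  obtain ⟨φ, hφ, h1, h2⟩ := h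
  have hm : TendstoInMeasure (volume.restrict Ω) φ atTop w := by
    refine tendstoInMeasure_of_tendsto_eLpNorm hq
      (fun n => (hφ n).continuous.aestronglyMeasurable) hw ?_
    refine h1.congr fun n => ?_
    rw [eLpNorm_sub_comm]
    rfl
  obtain ⟨ns, hns, hae⟩ := hm.exists_seq_tendsto_ae
  exact ⟨fun n => φ (ns n), fun n => hφ _, h1.comp hns.tendsto_atTop,
    h2.comp hns.tendsto_atTop, hae⟩

lemma tendsto_integral_of_eLpNorm_sub_le {α E : Type*} [MeasurableSpace α]
    [NormedAddCommGroup E] [NormedSpace ℝ E]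
    {μ : Measure α} {F : ℕ → α → E} {f : α → E} (hf : Integrable f μ)
    (hF : ∀ n, Integrable (F n) μ) {D : ℕ → ℝ≥0∞} (hD : Tendsto D atTop (𝓝 0)) {C : ℝ≥0∞}
    (hC : C ≠ ⊤) (hle : ∀ n, eLpNorm (F n - f) 1 μ ≤ C * D n) :
    Tendsto (fun n => ∫ x, F n x ∂μ) atTop (𝓝 (∫ x, f x ∂μ)) := by
  refine tendsto_integral_of_L1' f hf.1 (Eventually.of_forall hF) ?_
  have h0 : Tendsto (fun n => C * D n) atTop (𝓝 0) := by
    simpa using ENNReal.Tendsto.const_mul hD (Or.inr hC)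
  exact tendsto_of_tendsto_of_tendsto_of_le_of_le tendsto_const_nhds h0 (fun _ => zero_le) hle

/-- The chain rule for a `C^1` function with derivative bounded by `1`. -/
lemma IsTestLimit.integral_comp_smul_gradient {N : ℕ} {Ω : Set (RN N)}
    [IsFiniteMeasure (volume.restrict Ω)] {w : RN N → ℝ} {G : RN N → RN N}
    (hw : Integrable w (volume.restrict Ω)) (hG : Integrable G (volume.restrict Ω))
    (h : IsTestLimit Ω 1 w G) {S g : ℝ → ℝ} (hS : ∀ s, HasDerivAt S (g s) s) (hg : Continuous g)
    (hg1 : ∀ s, |g s| ≤ 1) {ψ : RN N → ℝ} (hψ : IsTestFunction Ω ψ) :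
    ∫ x in Ω, S (w x) • gradient ψ x = - ∫ x in Ω, ψ x • (g (w x) • G x) := by
  obtain ⟨φ, hφ, h1, h2, hae⟩ := h.exists_tendsto_ae one_ne_zero hw.1
  obtain ⟨M, hM0, hM1, hM2⟩ := hψ.exists_bound
  have hSd : ContDiff ℝ 1 S := by
    rw [contDiff_one_iff_deriv]
    refine ⟨fun s => (hS s).differentiableAt, ?_⟩
    rwa [show deriv S = g from funext fun s => (hS s).deriv]
  have hSL : ∀ s t, |S s - S t| ≤ |s - t| := fun s t => by
    have := Convex.norm_image_sub_le_of_norm_hasDerivWithin_le (f := S) (f' := g) (C := 1)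
      (s := Set.univ) (x := t) (y := s) (fun x _ => (hS x).hasDerivWithinAt) (fun x _ => hg1 x)
      convex_univ trivial trivial
    simpa using this
  have hφi : ∀ n, Integrable (φ n) (volume.restrict Ω) := fun n =>
    ((hφ n).continuous.integrable_of_hasCompactSupport (hφ n).2.1).restrict
  have hGφi : ∀ n, Integrable (gradient (φ n)) (volume.restrict Ω) := fun n =>
    ((hφ n).continuous_gradient.integrable_of_hasCompactSupport
      (hφ n).hasCompactSupport_gradient).restrict
  have hSi : ∀ {z : RN N → ℝ}, Integrable z (volume.restrict Ω) →
      Integrable (fun x => S (z x) • gradient ψ x) (volume.restrict Ω) := fun {z} hz => by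
    have hi : Integrable (fun x => S (z x)) (volume.restrict Ω) := by
      refine ((hz.norm.add (integrable_const |S 0|)).mono'
        (hSd.continuous.comp_aestronglyMeasurable hz.1) (Eventually.of_forall fun x => ?_))
      have := hSL (z x) 0
      have h3 := abs_sub_abs_le_abs_sub (S (z x)) (S 0)
      simp only [sub_zero] at this
      simp only [Pi.add_apply, Real.norm_eq_abs]
      linarith
    exact hi.smul_bdd M hψ.continuous_gradient.aestronglyMeasurable (Eventually.of_forall hM2)
  have hm : ∀ {z : RN N → ℝ}, AEStronglyMeasurable z (volume.restrict Ω) →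
      AEStronglyMeasurable (fun x => ψ x * g (z x)) (volume.restrict Ω) := fun hz =>
    hψ.continuous.aestronglyMeasurable.mul (hg.comp_aestronglyMeasurable hz)
  have hb : ∀ x s, ‖ψ x * g s‖ ≤ M := fun x s => by
    rw [norm_mul]
    exact (mul_le_of_le_one_right (norm_nonneg _) (hg1 s)).trans (hM1 x)
  have hRi : ∀ {z : RN N → ℝ} {H : RN N → RN N}, AEStronglyMeasurable z (volume.restrict Ω) →
      Integrable H (volume.restrict Ω) →
      Integrable (fun x => (ψ x * g (z x)) • H x) (volume.restrict Ω) := fun hz hH =>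
    hH.bdd_smul M (hm hz) (Eventually.of_forall fun x => hb x _)
  -- convergence of the left-hand sides
  have hL : Tendsto (fun n => ∫ x in Ω, S (φ n x) • gradient ψ x) atTop
      (𝓝 (∫ x in Ω, S (w x) • gradient ψ x)) := by
    refine tendsto_integral_of_eLpNorm_sub_le (hSi hw) (fun n => hSi (hφi n)) h1
      (C := ENNReal.ofReal M) ENNReal.ofReal_ne_top fun n => ?_
    refine eLpNorm_le_mul_eLpNorm_of_ae_le_mul (Eventually.of_forall fun x => ?_) 1
    simp only [Pi.sub_apply, ← sub_smul, norm_smul, Real.norm_eq_abs]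
    rw [mul_comm, abs_sub_comm (w x)]
    exact mul_le_mul (hM2 x) (hSL _ _) (abs_nonneg _) hM0
  -- convergence of the right-hand sides
  have hR1 : Tendsto (fun n => ∫ x in Ω, (ψ x * g (φ n x)) • (gradient (φ n) x - G x)) atTop
      (𝓝 (∫ x in Ω, (0 : RN N))) := by
    refine tendsto_integral_of_eLpNorm_sub_le (f := fun _ => 0) (integrable_zero _ _ _)
      (fun n => hRi (hφi n).1 ((hGφi n).sub hG)) h2
      (C := ENNReal.ofReal M) ENNReal.ofReal_ne_top fun n => ?_
    refine eLpNorm_le_mul_eLpNorm_of_ae_le_mul (Eventually.of_forall fun x => ?_) 1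
    simp only [Pi.sub_apply, sub_zero, norm_smul]
    rw [norm_sub_rev (G x)]
    gcongr
    exact hb x _
  -- As `g` is merely continuous, no norm bound on `g(φ n) - g(w)` is at hand; a.e. convergence and
  -- domination by `M ‖G‖` replace it.
  have hR2 : Tendsto (fun n => ∫ x in Ω, (ψ x * g (φ n x)) • G x) atTop
      (𝓝 (∫ x in Ω, (ψ x * g (w x)) • G x)) := by
    refine tendsto_integral_of_dominated_convergence (fun x => M * ‖G x‖)
      (fun n => (hRi (hφi n).1 hG).1) (hG.norm.const_mul M)
      (fun n => Eventually.of_forall fun x => ?_) ?_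
    · rw [norm_smul]
      gcongr
      exact hb x _
    · filter_upwards [hae] with x hx
      exact ((tendsto_const_nhds.mul ((hg.tendsto _).comp hx))).smul_const _
  have hR : Tendsto (fun n => - ∫ x in Ω, (ψ x * g (φ n x)) • gradient (φ n) x) atTop
      (𝓝 (- ∫ x in Ω, (ψ x * g (w x)) • G x)) := by
    have := (hR1.add hR2).neg
    simp only [integral_zero, zero_add] at this
    refine this.congr fun n => ?_
    have e := integral_add (hRi (hφi n).1 ((hGφi n).sub hG)) (hRi (hφi n).1 hG)
    simp only [Pi.sub_apply] at e
    rw [← e]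
    congr 2
    ext1 x
    rw [← smul_add, sub_add_cancel]
  have heq : ∀ n, ∫ x in Ω, S (φ n x) • gradient ψ x
      = - ∫ x in Ω, (ψ x * g (φ n x)) • gradient (φ n) x := fun n => by
    have hc : ContDiff ℝ 1 (fun x => S (φ n x)) := hSd.comp (hφ n).contDiff_one
    have e := integral_smul_gradient_eq_neg hc hψ
    have hgr : ∀ x, gradient (fun x => S (φ n x)) x = g (φ n x) • gradient (φ n) x := fun x => by
      have := (hS (φ n x)).comp_hasFDerivAt x
        ((hφ n).contDiff_one.differentiable one_ne_zero x).hasFDerivAt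
      have h3 : fderiv ℝ (fun x => S (φ n x)) x = g (φ n x) • fderiv ℝ (φ n) x := this.fderiv
      simp [gradient, h3]
    simp only [hgr, smul_smul] at e
    rw [setIntegral_eq_integral_of_forall_compl_eq_zero, e,
      setIntegral_eq_integral_of_forall_compl_eq_zero]
    · intro x hx; simp [hψ.eq_zero hx]
    · intro x hx; simp [hψ.gradient_eq_zero hx]
  have := tendsto_nhds_unique (hL.congr heq) hR
  simpa only [smul_smul] using this

/-- A continuous approximation of the indicator of `(-∞, k]`. -/
def ramp (k : ℝ) (n : ℕ) (s : ℝ) : ℝ := max 0 (min 1 (1 - n * (s - k)))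

lemma continuous_ramp (k : ℝ) (n : ℕ) : Continuous (ramp k n) := by
  unfold ramp; fun_prop

lemma abs_ramp_le (k : ℝ) (n : ℕ) (s : ℝ) : |ramp k n s| ≤ 1 := by
  rw [abs_of_nonneg (le_max_left _ _)]
  exact max_le zero_le_one (min_le_left _ _)

/-- Every ramp equals `1` up to and including `k`, so the limit is the indicator of the closed
half-line, and it is never necessary to know that the gradient vanishes on `{w = k}`. -/
lemma ramp_tendsto (k s : ℝ) :
    Tendsto (fun n => ramp k n s) atTop (𝓝 ((Set.Iic k).indicator 1 s)) := by
  by_cases hs : s ≤ k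
  · refine tendsto_const_nhds.congr fun n => ?_
    have : 0 ≤ (n : ℝ) * (k - s) := mul_nonneg n.cast_nonneg (sub_nonneg.2 hs)
    have h1 : (1 : ℝ) ≤ 1 - n * (s - k) := by nlinarith
    simp [ramp, hs, min_eq_left h1]
  · push Not at hs
    obtain ⟨m, hm⟩ := exists_nat_gt (1 / (s - k))
    refine tendsto_const_nhds.congr' ?_
    filter_upwards [eventually_ge_atTop m] with n hn
    have h0 : 0 < s - k := sub_pos.2 hs
    have h1 : 1 < (n : ℝ) * (s - k) := by
      rw [div_lt_iff₀ h0] at hm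
      have : (m : ℝ) ≤ n := by exact_mod_cast hn
      nlinarith
    have h2 : (1 : ℝ) - n * (s - k) ≤ 0 := by linarith
    rw [Set.indicator_of_notMem (by simpa using hs), ramp, max_eq_left]
    exact (min_le_right _ _).trans h2

lemma integral_ramp_tendsto {k s : ℝ} (hk : 0 < k) (hs : 0 ≤ s) :
    Tendsto (fun n => ∫ t in (0 : ℝ)..s, ramp k n t) atTop (𝓝 (min s k)) := by
  have h := intervalIntegral.tendsto_integral_filter_of_dominated_convergence (a := 0) (b := s)
    (μ := volume) (F := fun n => ramp k n) (l := atTop) (f := (Set.Iic k).indicator 1) (fun _ => 1)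
    (Eventually.of_forall fun n => (continuous_ramp k n).aestronglyMeasurable)
    (Eventually.of_forall fun n => Eventually.of_forall fun x _ => abs_ramp_le k n x)
    intervalIntegrable_const (Eventually.of_forall fun x _ => ramp_tendsto k x)
  have e : ∫ t in (0 : ℝ)..s, (Set.Iic k).indicator (1 : ℝ → ℝ) t = min s k := by
    rw [intervalIntegral.integral_of_le hs, setIntegral_indicator measurableSet_Iic,
      Set.Ioc_inter_Iic]
    simp only [Pi.one_apply, integral_const, smul_eq_mul, mul_one, measureReal_restrict_apply_univ]
    rw [Real.volume_real_Ioc_of_le (le_min hs hk.le)]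
    simp
  rwa [e] at h

/-- The chain rule for the truncation of a nonnegative function. -/
lemma IsTestLimit.integral_min_smul_gradient {N : ℕ} {Ω : Set (RN N)}
    [IsFiniteMeasure (volume.restrict Ω)] {w : RN N → ℝ} {G : RN N → RN N}
    (hw : Integrable w (volume.restrict Ω)) (hG : Integrable G (volume.restrict Ω))
    (hw0 : ∀ᵐ x ∂(volume.restrict Ω), 0 ≤ w x)
    (h : IsTestLimit Ω 1 w G) {k : ℝ} (hk : 0 < k) {ψ : RN N → ℝ} (hψ : IsTestFunction Ω ψ) :
    ∫ x in Ω, min (w x) k • gradient ψ x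
      = - ∫ x in Ω, ψ x • {x | w x ≤ k}.indicator G x := by
  obtain ⟨M, hM0, hM1, hM2⟩ := hψ.exists_bound
  set S : ℕ → ℝ → ℝ := fun n s => ∫ t in (0 : ℝ)..s, ramp k n t with hSdef
  have hS : ∀ n s, HasDerivAt (S n) (ramp k n s) s := fun n s =>
    ((continuous_ramp k n).integral_hasStrictDerivAt 0 s).hasDerivAt
  have hSc : ∀ n, Continuous (S n) := fun n =>
    continuous_iff_continuousAt.2 fun s => (hS n s).continuousAt
  have hSb : ∀ n s, |S n s| ≤ |s| := fun n s => by
    have := intervalIntegral.norm_integral_le_of_norm_le_const (a := 0) (b := s) (C := 1)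
      (f := ramp k n) fun x _ => abs_ramp_le k n x
    simpa using this
  have hL : Tendsto (fun n => ∫ x in Ω, S n (w x) • gradient ψ x) atTop
      (𝓝 (∫ x in Ω, min (w x) k • gradient ψ x)) := by
    refine tendsto_integral_of_dominated_convergence (fun x => |w x| * M)
      (fun n => ((hSc n).comp_aestronglyMeasurable hw.1).smul
        hψ.continuous_gradient.aestronglyMeasurable) (hw.abs.mul_const M)
      (fun n => Eventually.of_forall fun x => ?_) ?_
    · rw [norm_smul]
      exact mul_le_mul (hSb _ _) (hM2 x) (norm_nonneg _) (abs_nonneg _)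
    · filter_upwards [hw0] with x hx
      exact (integral_ramp_tendsto hk hx).smul_const _
  have hR : Tendsto (fun n => - ∫ x in Ω, ψ x • (ramp k n (w x) • G x)) atTop
      (𝓝 (- ∫ x in Ω, ψ x • {x | w x ≤ k}.indicator G x)) := by
    refine (tendsto_integral_of_dominated_convergence (fun x => M * ‖G x‖)
      (fun n => hψ.continuous.aestronglyMeasurable.smul
        (((continuous_ramp k n).comp_aestronglyMeasurable hw.1).smul hG.1)) (hG.norm.const_mul M)
      (fun n => Eventually.of_forall fun x => ?_) (Eventually.of_forall fun x => ?_)).neg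
    · change ‖ψ x • (ramp k n (w x) • G x)‖ ≤ _
      rw [norm_smul, norm_smul]
      exact mul_le_mul (hM1 x) (mul_le_of_le_one_left (norm_nonneg _) (abs_ramp_le _ _ _))
        (by positivity) hM0
    · have := (((ramp_tendsto k (w x)).smul_const (G x)).const_smul (ψ x))
      have e : {x | w x ≤ k}.indicator G x = (Set.Iic k).indicator (1 : ℝ → ℝ) (w x) • G x := by
        by_cases hx : w x ≤ k <;> simp [Set.indicator, hx]
      rw [e]
      exact this
  exact tendsto_nhds_unique (hL.congr fun n =>
    h.integral_comp_smul_gradient hw hG (hS n) (continuous_ramp k n) (abs_ramp_le k n) hψ) hR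

/-! ### Truncations -/

lemma trunc_of_nonneg {k s : ℝ} (hk : 0 < k) (hs : 0 ≤ s) : trunc k s = min s k :=
  max_eq_right ((neg_nonpos.2 hk.le).trans (le_min hs hk.le))

lemma abs_trunc_le {k : ℝ} (hk : 0 < k) (s : ℝ) : |trunc k s| ≤ k :=
  abs_le.2 ⟨le_max_left _ _, max_le (by linarith) (min_le_right _ _)⟩

/-- Puts the function in the entropy inequality into the linear span of truncations of `u`, whose
weak gradients are available. -/
lemma trunc_sub_trunc {k j s : ℝ} (hk : 0 < k) (hj : 0 < j) (hs : 0 ≤ s) :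
    trunc j (s - trunc k s) = trunc (k + j) s - trunc k s := by
  rw [trunc_of_nonneg hk hs, trunc_of_nonneg (add_pos hk hj) hs,
    trunc_of_nonneg hj (sub_nonneg.2 (min_le_left _ _))]
  rcases le_total s k with h | h
  · rw [min_eq_left h, min_eq_left (by linarith : s ≤ k + j)]; simp [hj.le]
  · rw [min_eq_right h, ← min_sub_sub_right, add_sub_cancel_left]

/-! ### The generalized gradient -/

lemma MemW01p.isTestLimit {N : ℕ} {Ω : Set (RN N)} {p : ℝ} {w : RN N → ℝ} (h : MemW01p Ω p w) :
    IsTestLimit Ω (ENNReal.ofReal p) w (weakGradient Ω w) := h.approx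

lemma MemW01p.hasWeakGradient {N : ℕ} {Ω : Set (RN N)} {p : ℝ} {w : RN N → ℝ}
    (h : MemW01p Ω p w) : HasWeakGradient Ω w (weakGradient Ω w) :=
  hasWeakGradient_weakGradient h.exists_grad

lemma MemW01p.hasWeakGradient_min {N : ℕ} {Ω : Set (RN N)} [IsFiniteMeasure (volume.restrict Ω)]
    {p : ℝ} (hp : 1 < p) {w : RN N → ℝ} (h : MemW01p Ω p w)
    (hw0 : ∀ᵐ x ∂(volume.restrict Ω), 0 ≤ w x) {k : ℝ} (hk : 0 < k) :
    HasWeakGradient Ω (fun x => min (w x) k) ({x | w x ≤ k}.indicator (weakGradient Ω w)) := by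
  have hp' : (1 : ℝ≥0∞) ≤ ENNReal.ofReal p := by simpa using hp.le
  have hw := h.memLp.integrable hp'
  have hG := h.grad_memLp.integrable hp'
  have hs : NullMeasurableSet {x | w x ≤ k} (volume.restrict Ω) :=
    nullMeasurableSet_le hw.1.aemeasurable aemeasurable_const
  refine ⟨?_, ?_, fun ψ hψ => (h.isTestLimit.mono_exponent one_ne_zero hp' hw.1
    hG.1).integral_min_smul_gradient hw hG hw0 hk hψ⟩
  · exact IntegrableOn.locallyIntegrableOn (hw.inf (integrable_const k))
  · exact IntegrableOn.locallyIntegrableOn (hG.indicator₀ hs)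

/-- For `k < j` and `u ≥ 0`, `T_k(u) = min(T_j(u), k)`, and the chain rule applies to `T_j(u)`. -/
lemma weakGradient_trunc_ae_eq_indicator {N : ℕ} {Ω : Set (RN N)} (hΩ : IsOpen Ω)
    [IsFiniteMeasure (volume.restrict Ω)] {p : ℝ} (hp : 1 < p) {u : RN N → ℝ}
    (hu0 : ∀ᵐ x ∂(volume.restrict Ω), 0 ≤ u x)
    (hu : ∀ k : ℝ, 0 < k → MemW01p Ω p (fun x => trunc k (u x))) {k j : ℝ} (hk : 0 < k)
    (hkj : k < j) :
    weakGradient Ω (fun x => trunc k (u x)) =ᵐ[volume.restrict Ω]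
      {x | |u x| ≤ k}.indicator (weakGradient Ω (fun x => trunc j (u x))) := by
  have hj := hk.trans hkj
  have h1 := (hu j hj).hasWeakGradient_min hp
    (hu0.mono fun x hx => by rw [trunc_of_nonneg hj hx]; exact le_min hx hj.le) hk
  have h2 := (hu k hk).hasWeakGradient.ae_eq hΩ h1 (hu0.mono fun x hx => by
    dsimp only
    rw [trunc_of_nonneg hj hx, trunc_of_nonneg hk hx, min_assoc, min_eq_right hkj.le])
  filter_upwards [h2, hu0] with x hx hx0
  rw [hx]
  -- The strict inequality `k < j` matters: where `u > j`, the value `j` of the truncation must lie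
  -- above `k`.
  have : (trunc j (u x) ≤ k) ↔ |u x| ≤ k := by
    rw [trunc_of_nonneg hj hx0, abs_of_nonneg hx0, min_le_iff]
    exact ⟨fun h => h.resolve_right (not_le.2 hkj), Or.inl⟩
  simp only [Set.indicator, Set.mem_ofPred_eq, this]

lemma AEMeasurable.apply_nat {α β : Type*} [MeasurableSpace α] [MeasurableSpace β]
    {μ : Measure α} {f : ℕ → α → β} (hf : ∀ n, AEMeasurable (f n) μ) {i : α → ℕ}
    (hi : AEMeasurable i μ) : AEMeasurable (fun x => f (i x) x) μ := by
  have hF : Measurable (fun q : α × ℕ => (hf q.2).mk _ q.1) :=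
    measurable_from_prod_countable_left fun n => (hf n).measurable_mk
  refine ⟨fun x => (hf (hi.mk i x)).mk _ x, hF.comp (measurable_id.prodMk hi.measurable_mk), ?_⟩
  filter_upwards [hi.ae_eq_mk, ae_all_iff.2 fun n => (hf n).ae_eq_mk] with x h1 h2
  rw [h2, ← h1]

/-- The gradients of the truncations are compatible, so they glue: at each point the gradient of a
truncation still inactive there is used. -/
lemma exists_isGeneralizedGradient {N : ℕ} {Ω : Set (RN N)} (hΩ : IsOpen Ω)
    [IsFiniteMeasure (volume.restrict Ω)] {p : ℝ} (hp : 1 < p) {u : RN N → ℝ}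
    (hum : AEMeasurable u (volume.restrict Ω))
    (hu0 : ∀ᵐ x ∂(volume.restrict Ω), 0 ≤ u x)
    (hu : ∀ k : ℝ, 0 < k → MemW01p Ω p (fun x => trunc k (u x))) :
    ∃ v, IsGeneralizedGradient Ω u v := by
  refine ⟨fun x => weakGradient Ω (fun y => trunc ((⌊|u x|⌋₊ : ℝ) + 1) (u y)) x, ?_, fun k hk => ?_⟩
  · exact AEMeasurable.apply_nat
      (f := fun n : ℕ => weakGradient Ω (fun y => trunc ((n : ℝ) + 1) (u y)))
      (fun n => (hu (n + 1) (by positivity)).grad_memLp.1.aemeasurable)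
      (Nat.measurable_floor.comp_aemeasurable (continuous_abs.measurable.comp_aemeasurable hum))
  · refine (hu k hk).hasWeakGradient.congr hΩ (ae_eq_refl _) ?_
    -- The height `n + 1 + k` exceeds both `n + 1` and `k`, so both gradients are compared with that
    -- of one common truncation.
    have hc := ae_all_iff.2 fun n : ℕ =>
      weakGradient_trunc_ae_eq_indicator hΩ hp hu0 hu (k := n + 1) (j := n + 1 + k)
        (by positivity) (by linarith)
    have hd := ae_all_iff.2 fun n : ℕ =>
      weakGradient_trunc_ae_eq_indicator hΩ hp hu0 hu (k := k) (j := n + 1 + k) hk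
        (by have : (0 : ℝ) ≤ n := n.cast_nonneg
            linarith)
    filter_upwards [hc, hd] with x h1 h2
    rw [h2 ⌊|u x|⌋₊]
    by_cases hx : |u x| ≤ k
    · simp only [Set.indicator, Set.mem_ofPred_eq, hx, if_true]
      rw [h1 ⌊|u x|⌋₊]
      simp only [Set.indicator, Set.mem_ofPred_eq, (Nat.lt_floor_add_one |u x|).le, if_true]
    · simp only [Set.indicator, Set.mem_ofPred_eq, hx, if_false]

lemma isGeneralizedGradient_generalizedGradient {N : ℕ} {Ω : Set (RN N)} {u : RN N → ℝ}
    (h : ∃ v, IsGeneralizedGradient Ω u v) :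
    IsGeneralizedGradient Ω u (generalizedGradient Ω u) := by
  rw [generalizedGradient, dif_pos h]
  exact h.choose_spec

/-! ### The Sobolev inequality -/

lemma eLpNorm_gradient {N : ℕ} (F : RN N → ℝ) (q : ℝ≥0∞) (μ : Measure (RN N)) :
    eLpNorm (gradient F) q μ = eLpNorm (fderiv ℝ F) q μ :=
  eLpNorm_congr_norm_ae (Eventually.of_forall fun x => norm_gradient F x)

/-- The Gagliardo–Nirenberg–Sobolev inequality for test functions survives the limit: Fatou on the
left, norm convergence of the gradients on the right. -/
lemma exists_sobolev_const {N : ℕ} (hN : 0 < N) {p q : ℝ≥0} (hp : 1 ≤ p)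
    (hq : (q : ℝ)⁻¹ = (p : ℝ)⁻¹ - (N : ℝ)⁻¹) (Ω : Set (RN N)) :
    ∃ C : ℝ≥0, ∀ (w : RN N → ℝ) (G : RN N → RN N),
      AEStronglyMeasurable w (volume.restrict Ω) → AEStronglyMeasurable G (volume.restrict Ω) →
      IsTestLimit Ω p w G →
      eLpNorm w q (volume.restrict Ω) ≤ C * eLpNorm G p (volume.restrict Ω) := by
  refine ⟨SNormLESNormFDerivOfEqConst ℝ (volume : Measure (RN N)) p, fun w G hw hG h => ?_⟩
  set C := SNormLESNormFDerivOfEqConst ℝ (volume : Measure (RN N)) p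
  have hp0 : (p : ℝ≥0∞) ≠ 0 := by
    have : p ≠ 0 := (zero_lt_one.trans_le hp).ne'
    exact_mod_cast this
  obtain ⟨φ, hφ, -, h2, hae⟩ := h.exists_tendsto_ae hp0 hw
  have hle : ∀ n, eLpNorm (φ n) q (volume.restrict Ω) ≤ C * (eLpNorm G p (volume.restrict Ω)
      + eLpNorm (fun x => G x - gradient (φ n) x) p (volume.restrict Ω)) := fun n => by
    have h3 := eLpNorm_le_eLpNorm_fderiv_of_eq (volume : Measure (RN N)) (hφ n).contDiff_one
      (hφ n).2.1 hp (p' := q) (by simpa using hN) (by simpa using hq)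
    rw [← eLpNorm_gradient, ← eLpNorm_restrict_eq_of_support_subset (s := Ω)
      (f := gradient (φ n)) fun x hx => by
        by_contra h0; exact hx ((hφ n).gradient_eq_zero h0)] at h3
    refine ((eLpNorm_mono_measure _ Measure.restrict_le_self).trans h3).trans ?_
    gcongr
    have h4 := eLpNorm_sub_le (p := p) hG (hG.sub
      ((hφ n).continuous_gradient.aestronglyMeasurable)) (by exact_mod_cast hp)
    have e : G - (G - gradient (φ n)) = gradient (φ n) := sub_sub_cancel _ _
    rw [e] at h4
    exact h4
  have hlim : Tendsto (fun n => C * (eLpNorm G p (volume.restrict Ω)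
      + eLpNorm (fun x => G x - gradient (φ n) x) p (volume.restrict Ω))) atTop
      (𝓝 (C * eLpNorm G p (volume.restrict Ω))) := by
    have := ENNReal.Tendsto.const_mul (a := (C : ℝ≥0∞)) (h2.const_add
      (eLpNorm G p (volume.restrict Ω))) (Or.inr ENNReal.coe_ne_top)
    simpa using this
  refine (Lp.eLpNorm_lim_le_liminf_eLpNorm
    (fun n => (hφ n).continuous.aestronglyMeasurable) w hae).trans ?_
  rw [← hlim.liminf_eq]
  exact liminf_le_liminf (Eventually.of_forall hle)

lemma IsTestLimit.sub {N : ℕ} {Ω : Set (RN N)} {q : ℝ≥0∞} (hq : 1 ≤ q) {w w' : RN N → ℝ}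
    {G G' : RN N → RN N} (hw : AEStronglyMeasurable w (volume.restrict Ω))
    (hw' : AEStronglyMeasurable w' (volume.restrict Ω))
    (hG : AEStronglyMeasurable G (volume.restrict Ω))
    (hG' : AEStronglyMeasurable G' (volume.restrict Ω))
    (h : IsTestLimit Ω q w G) (h' : IsTestLimit Ω q w' G') :
    IsTestLimit Ω q (fun x => w x - w' x) (fun x => G x - G' x) := by
  obtain ⟨φ, hφ, h1, h2⟩ := h
  obtain ⟨ψ, hψ, h3, h4⟩ := h'
  refine ⟨fun n x => φ n x - ψ n x, fun n => (hφ n).sub (hψ n), ?_, ?_⟩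
  · have := h1.add h3
    rw [add_zero] at this
    refine tendsto_of_tendsto_of_tendsto_of_le_of_le tendsto_const_nhds this (fun _ => zero_le)
      fun n => ?_
    refine le_trans (le_of_eq ?_) (eLpNorm_sub_le
      (hw.sub (hφ n).continuous.aestronglyMeasurable)
      (hw'.sub (hψ n).continuous.aestronglyMeasurable) hq)
    congr 1
    ext1 x
    simp only [Pi.sub_apply]
    ring
  · have := h2.add h4
    rw [add_zero] at this
    refine tendsto_of_tendsto_of_tendsto_of_le_of_le tendsto_const_nhds this (fun _ => zero_le)
      fun n => ?_
    refine le_trans (le_of_eq ?_) (eLpNorm_sub_le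
      (hG.sub (hφ n).continuous_gradient.aestronglyMeasurable)
      (hG'.sub (hψ n).continuous_gradient.aestronglyMeasurable) hq)
    congr 1
    ext1 x
    simp only [Pi.sub_apply, (hφ n).gradient_sub (hψ n)]
    abel

lemma IsTestLimit.congr {N : ℕ} {Ω : Set (RN N)} {q : ℝ≥0∞} {w w' : RN N → ℝ}
    {G G' : RN N → RN N} (h : IsTestLimit Ω q w G) (hw : w =ᵐ[volume.restrict Ω] w')
    (hG : G =ᵐ[volume.restrict Ω] G') : IsTestLimit Ω q w' G' := by
  obtain ⟨φ, hφ, h1, h2⟩ := h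
  refine ⟨φ, hφ, h1.congr fun n => eLpNorm_congr_ae ?_, h2.congr fun n => eLpNorm_congr_ae ?_⟩
  · filter_upwards [hw] with x hx
    rw [hx]
  · filter_upwards [hG] with x hx
    rw [hx]

/-! ### Estimates on level sets -/

/-- All three claims come from writing the function as `T_{k+j}(u) - T_k(u)`: the two gradients
cancel where `u ≤ k`, and both vanish where `u > k + j`. -/
lemma level_gradient {N : ℕ} {Ω : Set (RN N)} (hΩ : IsOpen Ω)
    [IsFiniteMeasure (volume.restrict Ω)] {p : ℝ} (hp : 1 < p) {u : RN N → ℝ}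
    (hu0 : ∀ᵐ x ∂(volume.restrict Ω), 0 ≤ u x)
    (hu : ∀ k : ℝ, 0 < k → MemW01p Ω p (fun x => trunc k (u x))) {v : RN N → RN N}
    (hv : IsGeneralizedGradient Ω u v) {k j : ℝ} (hk : 0 < k) (hj : 0 < j) :
    weakGradient Ω (fun x => trunc j (u x - trunc k (u x))) =ᵐ[volume.restrict Ω]
        {x | k < u x ∧ u x ≤ k + j}.indicator v ∧
      MemLp ({x | k < u x ∧ u x ≤ k + j}.indicator v) (ENNReal.ofReal p) (volume.restrict Ω) ∧
      IsTestLimit Ω (ENNReal.ofReal p) (fun x => trunc j (u x - trunc k (u x)))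
        ({x | k < u x ∧ u x ≤ k + j}.indicator v) := by
  have hkj := add_pos hk hj
  have m1 := hu _ hkj
  have m2 := hu _ hk
  have e1 := m1.hasWeakGradient.ae_eq hΩ (hv.2 _ hkj) (ae_eq_refl _)
  have e2 := m2.hasWeakGradient.ae_eq hΩ (hv.2 _ hk) (ae_eq_refl _)
  have eD : (fun x => weakGradient Ω (fun x => trunc (k + j) (u x)) x -
      weakGradient Ω (fun x => trunc k (u x)) x) =ᵐ[volume.restrict Ω]
      {x | k < u x ∧ u x ≤ k + j}.indicator v := by
    filter_upwards [e1, e2, hu0] with x h1 h2 h0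
    rw [h1, h2]
    simp only [Set.indicator, Set.mem_ofPred_eq, abs_of_nonneg h0]
    by_cases a1 : u x ≤ k
    · simp [a1, not_lt.2 a1, a1.trans (by linarith : k ≤ k + j)]
    · simp [a1, not_le.1 a1]
  have eW : (fun x => trunc (k + j) (u x) - trunc k (u x)) =ᵐ[volume.restrict Ω]
      fun x => trunc j (u x - trunc k (u x)) := by
    filter_upwards [hu0] with x h0
    rw [trunc_sub_trunc hk hj h0]
  have hg := (m1.hasWeakGradient.sub m2.hasWeakGradient).congr hΩ eW eD
  refine ⟨(hasWeakGradient_weakGradient ⟨_, hg⟩).ae_eq hΩ hg (ae_eq_refl _),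
    (memLp_congr_ae eD).1 (m1.grad_memLp.sub m2.grad_memLp), ?_⟩
  exact (IsTestLimit.sub (by simpa using hp.le) m1.memLp.1 m2.memLp.1 m1.grad_memLp.1
    m2.grad_memLp.1 m1.isTestLimit m2.isTestLimit).congr eW eD

lemma integrable_inner_of_memLp {α E : Type*} [MeasurableSpace α] {μ : Measure α}
    [NormedAddCommGroup E] [InnerProductSpace ℝ E] {p : ℝ} (hp : 1 < p) {F G : α → E}
    (hF : MemLp F (ENNReal.ofReal (p / (p - 1))) μ) (hG : MemLp G (ENNReal.ofReal p) μ) :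
    Integrable (fun x => inner ℝ (F x) (G x)) μ := by
  have hc : (ENNReal.ofReal (p / (p - 1))).HolderConjugate (ENNReal.ofReal p) :=
    (Real.HolderConjugate.conjExponent hp).symm.ennrealOfReal
  have hi := hF.norm.integrable_mul hG.norm
  exact hi.mono' (hF.1.inner hG.1) (Eventually.of_forall fun x => norm_inner_le_norm _ _)

lemma source_toReal_le {N : ℕ} {h : ℝ≥0 → ℝ≥0∞} {γ₂ c₂ : ℝ} {s₂ : ℝ≥0} (hγ₂ : 0 ≤ γ₂)
    (hc₂ : 0 < c₂) (hh : ∀ s : ℝ≥0, s₂ ≤ s → h s ≤ ENNReal.ofReal (c₂ / (s : ℝ) ^ γ₂))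
    {f u : RN N → ℝ} {x : RN N} (hf : 0 ≤ f x) {k : ℝ} (hk : 0 < k) (hks : s₂ ≤ k)
    (hx : k < u x) : (source h f u x).toReal ≤ c₂ / k ^ γ₂ * f x := by
  have hu0 : 0 ≤ u x := (hk.trans hx).le
  have h1 : (h (u x).toNNReal).toReal ≤ c₂ / k ^ γ₂ := by
    refine (ENNReal.toReal_le_of_le_ofReal (by positivity) (hh _ ?_)).trans ?_
    · exact NNReal.coe_le_coe.1 (by rw [Real.coe_toNNReal _ hu0]; exact hks.trans hx.le)
    · rw [Real.coe_toNNReal _ hu0]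
      gcongr
  rw [source, ENNReal.toReal_mul, ENNReal.toReal_ofReal hf]
  exact mul_le_mul_of_nonneg_right h1 hf

/-- The energy estimate on the level set `{k < u ≤ k + j}`. -/
lemma energy_level_le {N : ℕ} {p : ℝ} (hp1 : 1 < p)
    {Ω : Set (RN N)} (hΩo : IsOpen Ω) [IsFiniteMeasure (volume.restrict Ω)]
    {a : RN N → ℝ → RN N → RN N} {b : ℝ → ℝ}
    (ha_coer : ∀ᵐ x ∂(volume.restrict Ω), ∀ (s : ℝ) (ξ : RN N),
      b s * ‖ξ‖ ^ p ≤ inner ℝ (a x s ξ) ξ)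
    {α θ : ℝ} (hα : 0 < α) (hθ : 0 ≤ θ)
    (hb : ∀ s : ℝ, α / (1 + |s|) ^ (θ * (p - 1)) ≤ b s)
    {h : ℝ≥0 → ℝ≥0∞} {γ₂ c₂ : ℝ} {s₂ : ℝ≥0} (hγ₂ : 0 ≤ γ₂) (hc₂ : 0 < c₂)
    (hh : ∀ s : ℝ≥0, s₂ ≤ s → h s ≤ ENNReal.ofReal (c₂ / (s : ℝ) ^ γ₂))
    (hθγ : θ ≤ 1 + γ₂ / (p - 1))
    {f : RN N → ℝ} (hf_nonneg : ∀ᵐ x ∂(volume.restrict Ω), 0 ≤ f x)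
    (hf : Integrable f (volume.restrict Ω))
    {u : RN N → ℝ} (hu : IsEntropySolution Ω p a h f u)
    (hv : IsGeneralizedGradient Ω u (generalizedGradient Ω u))
    {k j : ℝ} (hk1 : 1 ≤ k) (hks : s₂ ≤ k) (hj : 0 < j) (hjk : j ≤ k) :
    ∫ x in Ω, ‖{x | k < u x ∧ u x ≤ k + j}.indicator (generalizedGradient Ω u) x‖ ^ p
      ≤ c₂ / α * 3 ^ (θ * (p - 1)) * k ^ (p - 1) *
        (j * ∫ x in {x | k < u x}, f x ∂(volume.restrict Ω)) := by
  set v := generalizedGradient Ω u with hvdef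
  have hk : 0 < k := zero_lt_one.trans_le hk1
  have hp0 : 0 < p := zero_lt_one.trans hp1
  have hkj := add_pos hk hj
  obtain ⟨hG, hGm, -⟩ := level_gradient hΩo hp1 hu.nonneg hu.trunc_mem hv hk hj
  set G := {x | k < u x ∧ u x ≤ k + j}.indicator v with hGdef
  have hφ : MemLp (fun x => trunc k (u x)) ∞ (volume.restrict Ω) :=
    memLp_top_of_bound (hu.trunc_mem k hk).memLp.1 k
      (Eventually.of_forall fun x => abs_trunc_le hk _)
  have hent := hu.entropy_le j hj _ (hu.trunc_mem k hk) hφ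
  have hsi := hu.source_integrable j hj _ (hu.trunc_mem k hk) hφ
  have hflux := hu.flux_memLp _ hkj
  have hgrad := (hu.trunc_mem _ hkj).hasWeakGradient.ae_eq hΩo (hv.2 _ hkj) (ae_eq_refl _)
  have hpow : 0 ≤ θ * (p - 1) := mul_nonneg hθ (by linarith)
  -- the left-hand side
  have hleft : ∫ x in Ω, α / (3 * k) ^ (θ * (p - 1)) * ‖G x‖ ^ p ≤
      ∫ x in Ω, inner ℝ (a x (u x) (v x))
        (weakGradient Ω (fun y => trunc j (u y - trunc k (u y))) x) := by
    have hGi := hGm.integrable_norm_rpow (by simpa using hp0) ENNReal.ofReal_ne_top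
    rw [ENNReal.toReal_ofReal hp0.le] at hGi
    refine integral_mono_ae (hGi.const_mul _) ?_ ?_
    -- The flux is controlled only at `T_{k+j}(u)`. This suffices: it is the flux at `u` on the
    -- band, and `G` vanishes elsewhere.
    · refine (integrable_inner_of_memLp hp1 hflux hGm).congr ?_
      filter_upwards [hG, hgrad, hu.nonneg] with x h1 h2 h0
      rw [h1]
      by_cases hx : k < u x ∧ u x ≤ k + j
      · rw [h2, Set.indicator_of_mem (by simpa [abs_of_nonneg h0] using hx.2),
          trunc_of_nonneg hkj h0, min_eq_left hx.2]
      · have : G x = 0 := Set.indicator_of_notMem (by simpa using hx) _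
        rw [this, inner_zero_right, inner_zero_right]
    · filter_upwards [hG, ha_coer, hu.nonneg] with x h1 h2 h0
      rw [h1]
      by_cases hx : k < u x ∧ u x ≤ k + j
      · have : G x = v x := Set.indicator_of_mem (by simpa using hx) _
        rw [this]
        refine le_trans ?_ (h2 _ _)
        gcongr
        refine le_trans ?_ (hb _)
        rw [abs_of_nonneg h0]
        gcongr
        -- `1 + u ≤ 1 + k + j ≤ 3k`, by `1 ≤ k` and `j ≤ k`.
        linarith [hx.2]
      · have : G x = 0 := Set.indicator_of_notMem (by simpa using hx) _
        rw [this, inner_zero_right, norm_zero, Real.zero_rpow hp0.ne', mul_zero]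
  -- the right-hand side
  have hright : ∫ x in Ω, (source h f u x).toReal * trunc j (u x - trunc k (u x)) ≤
      c₂ / k ^ γ₂ * j * ∫ x in {x | k < u x}, f x ∂(volume.restrict Ω) := by
    have hs : NullMeasurableSet {x | k < u x} (volume.restrict Ω) :=
      nullMeasurableSet_lt aemeasurable_const hu.measurable
    rw [← integral_indicator₀ hs, ← integral_const_mul]
    refine integral_mono_ae hsi ((hf.indicator₀ hs).const_mul _) ?_
    filter_upwards [hu.nonneg, hf_nonneg] with x h0 hfx
    by_cases hx : k < u x
    · rw [Set.indicator_of_mem (by simpa using hx), mul_right_comm]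
      refine mul_le_mul (source_toReal_le hγ₂ hc₂ hh hfx hk hks hx)
        ((le_abs_self _).trans (abs_trunc_le hj _)) ?_ (by positivity)
      rw [trunc_of_nonneg hk h0, min_eq_right hx.le, trunc_of_nonneg hj (by linarith)]
      exact le_min (by linarith) hj.le
    -- Where `u ≤ k` the truncated difference is zero, so a singularity of `h` at `0` plays no role.
    · rw [Set.indicator_of_notMem (by simpa using hx), trunc_of_nonneg hk h0,
        min_eq_left (not_lt.1 hx), sub_self, trunc_of_nonneg hj le_rfl, min_eq_left hj.le]
      simp
  have hmain := hleft.trans (hent.trans hright)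
  rw [integral_const_mul] at hmain
  set I := ∫ x in Ω, ‖G x‖ ^ p
  set R := ∫ x in {x | k < u x}, f x ∂(volume.restrict Ω)
  have hR : 0 ≤ R := integral_nonneg_of_ae (ae_restrict_of_ae hf_nonneg)
  rw [Real.mul_rpow (by norm_num) hk.le] at hmain
  have h3 : (0 : ℝ) < 3 ^ (θ * (p - 1)) := by positivity
  have hkθ : 0 < k ^ (θ * (p - 1)) := by positivity
  have hI : I ≤ c₂ / α * 3 ^ (θ * (p - 1)) * (k ^ (θ * (p - 1)) / k ^ γ₂) * (j * R) := by
    rw [div_mul_eq_mul_div, div_le_iff₀ (by positivity)] at hmain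
    rw [← mul_le_mul_iff_right₀ hα]
    refine hmain.trans (le_of_eq ?_)
    field_simp
  refine hI.trans ?_
  gcongr
  rw [← Real.rpow_sub hk]
  -- The bound on `θ` enters here, as `θ(p-1) - γ₂ ≤ p - 1`; comparing the powers needs `k ≥ 1`.
  refine Real.rpow_le_rpow_of_exponent_le hk1 ?_
  have h4 := mul_le_mul_of_nonneg_right hθγ (by linarith : 0 ≤ p - 1)
  rw [add_mul, div_mul_cancel₀ _ (by linarith : p - 1 ≠ 0)] at h4
  linarith

/-- Hölder's inequality against the constant `1` on `s`. -/
lemma integral_level_le {α : Type*} [MeasurableSpace α] {μ : Measure α} [IsFiniteMeasure μ]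
    {m : ℝ} (hm : 1 ≤ m) {f : α → ℝ} (hf : MemLp f (ENNReal.ofReal m) μ) (s : Set α) :
    ∫ x in s, f x ∂μ ≤ (eLpNorm f (ENNReal.ofReal m) μ).toReal * μ.real s ^ (1 - 1 / m) := by
  have hm0 : 0 < m := zero_lt_one.trans_le hm
  have h1 := eLpNorm_le_eLpNorm_mul_rpow_measure_univ (μ := μ.restrict s) (p := 1)
    (q := ENNReal.ofReal m) (by simpa using hm) hf.1.restrict
  have hexp : 0 ≤ 1 - 1 / m := by
    rw [sub_nonneg, div_le_one hm0]; exact hm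
  rw [ENNReal.toReal_one, ENNReal.toReal_ofReal hm0.le, Measure.restrict_apply_univ, div_one] at h1
  have h2 := h1.trans (mul_le_mul_left (eLpNorm_mono_measure f Measure.restrict_le_self) _)
  refine (Real.le_norm_self _).trans ((norm_integral_le_lintegral_norm _).trans ?_)
  rw [Measure.real, ENNReal.toReal_rpow, ← ENNReal.toReal_mul]
  refine ENNReal.toReal_mono (ENNReal.mul_ne_top hf.eLpNorm_ne_top
    (ENNReal.rpow_ne_top_of_nonneg hexp (measure_ne_top _ _))) ?_
  rw [eLpNorm_one_eq_lintegral_enorm] at h2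
  simpa only [ofReal_norm] using h2

/-- Chebyshev's inequality in `L^q`, followed by the Sobolev-type bound `h`. -/
lemma measure_ge_le_of_eLpNorm_le {α E : Type*} [MeasurableSpace α] [NormedAddCommGroup E]
    {μ : Measure α} [IsFiniteMeasure μ] {p q : ℝ} (hp : 0 < p) (hq : 0 < q) {C : ℝ≥0} {w : α → ℝ}
    {G : α → E} (hw : AEStronglyMeasurable w μ) (hG : MemLp G (ENNReal.ofReal p) μ)
    (h : eLpNorm w (ENNReal.ofReal q) μ ≤ C * eLpNorm G (ENNReal.ofReal p) μ) {j : ℝ} (hj : 0 < j) :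
    μ.real {x | j ≤ |w x|} ≤ C ^ q * ((∫ x, ‖G x‖ ^ p ∂μ) / j ^ p) ^ (q / p) := by
  have h1 := mul_meas_ge_le_pow_eLpNorm' μ (p := ENNReal.ofReal q) (by simpa using hq)
    ENNReal.ofReal_ne_top hw (ENNReal.ofReal j)
  have hI : 0 ≤ ∫ x, ‖G x‖ ^ p ∂μ := integral_nonneg fun x => by positivity
  rw [ENNReal.toReal_ofReal hq.le] at h1
  rw [hG.eLpNorm_eq_integral_rpow_norm (by simpa using hp) ENNReal.ofReal_ne_top,
    ENNReal.toReal_ofReal hp.le] at h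
  have h2 := h1.trans (ENNReal.rpow_le_rpow h hq.le)
  have hset : {x | ENNReal.ofReal j ≤ ‖w x‖ₑ} = {x | j ≤ |w x|} := by
    ext x
    simp only [Set.mem_ofPred_eq]
    rw [← ofReal_norm, ENNReal.ofReal_le_ofReal_iff (norm_nonneg _), Real.norm_eq_abs]
  rw [hset] at h2
  have h3 := ENNReal.toReal_mono (ENNReal.rpow_ne_top_of_nonneg hq.le
    (ENNReal.mul_ne_top ENNReal.coe_ne_top ENNReal.ofReal_ne_top)) h2
  rw [ENNReal.toReal_mul, ← ENNReal.toReal_rpow, ENNReal.toReal_ofReal hj.le,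
    ← ENNReal.toReal_rpow, ENNReal.toReal_mul, ENNReal.toReal_ofReal (by positivity),
    ENNReal.coe_toReal, Real.mul_rpow (by positivity) (by positivity), ← Real.rpow_mul hI,
    inv_mul_eq_div] at h3
  rw [Real.div_rpow hI (by positivity), ← Real.rpow_mul hj.le, mul_div_cancel₀ _ hp.ne', ← mul_div_assoc,
    le_div_iff₀ (by positivity), mul_comm]
  exact h3

/-! ### Iteration on the levels -/

/-- A scale-invariant version of Stampacchia's lemma. -/
lemma exists_eq_zero_of_level_le {A : ℝ → ℝ} (hA0 : ∀ t, 0 ≤ A t) (hAm : Antitone A)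
    (hAt : Tendsto A atTop (𝓝 0)) {C κ β K : ℝ} (hC : 0 < C) (hκ : 0 < κ) (hβ : 1 < β)
    (hA : ∀ k j : ℝ, K ≤ k → 0 < j → j ≤ k → A (k + j) ≤ C * (k / j) ^ κ * A k ^ β) :
    ∃ k, A k = 0 := by
  set C' : ℝ := C * 4 ^ κ
  have hC' : 0 < C' := by positivity
  have hβ1 : 0 < β - 1 := sub_pos.2 hβ
  -- The decay rate is chosen so that `r^(β-1)` cancels the growth `2^κ` of the factor `(k/j)^κ` per
  -- step; `δ` below is chosen so that `C' δ^(β-1)` supplies the next factor `r`.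
  set r : ℝ := (2 : ℝ) ^ (-(κ / (β - 1))) with hr
  have hr0 : 0 < r := by positivity
  have hr1 : r < 1 := Real.rpow_lt_one_of_one_lt_of_neg one_lt_two (by
    have : 0 < κ / (β - 1) := by positivity
    linarith)
  have hBr : (2 : ℝ) ^ κ * r ^ (β - 1) = 1 := by
    rw [hr, ← Real.rpow_mul zero_le_two, ← Real.rpow_add two_pos, neg_mul,
      div_mul_cancel₀ _ hβ1.ne', add_neg_cancel, Real.rpow_zero]
  set δ : ℝ := (r / C') ^ (β - 1)⁻¹ with hδ
  have hδ0 : 0 < δ := by positivity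
  have hδ1 : C' * δ ^ (β - 1) = r := by
    rw [hδ, Real.rpow_inv_rpow (by positivity) hβ1.ne', mul_div_cancel₀ _ hC'.ne']
  obtain ⟨k₀, hk₀δ, hk₀K, hk₀1⟩ : ∃ k₀, A k₀ < δ ∧ K ≤ k₀ ∧ 1 ≤ k₀ :=
    ((hAt.eventually (gt_mem_nhds hδ0)).and
      ((eventually_ge_atTop K).and (eventually_ge_atTop 1))).exists
  have hk₀ : 0 < k₀ := zero_lt_one.trans_le hk₀1
  -- Levels rising from `k₀` to `2k₀`. The increments `k₀ / 2^(n+1)` make the ratio level/increment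
  -- at most `4 · 2^n`, whatever `k₀` is.
  set k : ℕ → ℝ := fun n => k₀ * (2 - (1 / 2) ^ n) with hkdef
  have hpow : ∀ n : ℕ, (0 : ℝ) < (1 / 2) ^ n ∧ ((1 : ℝ) / 2) ^ n ≤ 1 := fun n =>
    ⟨by positivity, pow_le_one₀ (by norm_num) (by norm_num)⟩
  have key : ∀ n, A (k n) ≤ δ * r ^ n := fun n => by
    induction n with
    | zero =>
      have : k 0 = k₀ := by simp only [hkdef, pow_zero]; ring
      rw [this, pow_zero, mul_one]
      exact hk₀δ.le
    | succ n ih =>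
      obtain ⟨hp0, hp1⟩ := hpow n
      set j : ℝ := k₀ * (1 / 2) ^ (n + 1) with hj
      have hj0 : 0 < j := by positivity
      have hkn : k₀ ≤ k n := le_mul_of_one_le_right hk₀.le (by linarith)
      have hjk : j ≤ k n := by
        refine le_trans ?_ hkn
        exact mul_le_of_le_one_right hk₀.le (hpow _).2
      have hs : k (n + 1) = k n + j := by
        simp only [hkdef, hj, pow_succ]; ring
      have hdiv : k n / j ≤ 4 * 2 ^ n := by
        rw [div_le_iff₀ hj0, hj, pow_succ]
        have h2 : (2 : ℝ) ^ n * (1 / 2) ^ n = 1 := by rw [← mul_pow]; norm_num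
        have : 4 * 2 ^ n * (k₀ * ((1 / 2) ^ n * (1 / 2))) = k₀ * 2 * (2 ^ n * (1 / 2) ^ n) := by
          ring
        rw [this, h2, mul_one]
        exact mul_le_mul_of_nonneg_left (by linarith) hk₀.le
      have hkn0 : 0 < k n := hk₀.trans_le hkn
      have hAn := hA0 (k n)
      rw [hs]
      calc A (k n + j) ≤ C * (k n / j) ^ κ * A (k n) ^ β := hA _ _ (hk₀K.trans hkn) hj0 hjk
        _ ≤ C * (4 * 2 ^ n) ^ κ * (δ * r ^ n) ^ β := by
            gcongr
        _ = (C' * δ ^ (β - 1)) * δ * ((2 : ℝ) ^ κ * r ^ (β - 1)) ^ n * r ^ n := by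
            have e1 : ((2 : ℝ) ^ n) ^ κ = (2 ^ κ) ^ n := by
              rw [← Real.rpow_natCast, ← Real.rpow_natCast, ← Real.rpow_mul zero_le_two,
                ← Real.rpow_mul zero_le_two, mul_comm]
            have e2 : (r ^ n) ^ (β - 1) = (r ^ (β - 1)) ^ n := by
              rw [← Real.rpow_natCast, ← Real.rpow_natCast, ← Real.rpow_mul hr0.le,
                ← Real.rpow_mul hr0.le, mul_comm]
            have e3 : (δ * r ^ n) ^ β = (δ * r ^ n) ^ (β - 1) * (δ * r ^ n) := by
              rw [← Real.rpow_add_one (by positivity), sub_add_cancel]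
            rw [e3, Real.mul_rpow hδ0.le (by positivity), e2,
              Real.mul_rpow (by norm_num) (by positivity), e1, mul_pow]
            ring
        _ = δ * r ^ (n + 1) := by
            rw [hδ1, hBr, one_pow, pow_succ]; ring
  refine ⟨2 * k₀, le_antisymm ?_ (hA0 _)⟩
  have hlim : Tendsto (fun n : ℕ => δ * r ^ n) atTop (𝓝 0) := by
    simpa using (tendsto_pow_atTop_nhds_zero_of_lt_one hr0.le hr1).const_mul δ
  refine ge_of_tendsto' hlim fun n => (hAm ?_).trans (key n)
  have := (hpow n).1
  simp only [hkdef]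
  nlinarith

lemma tendsto_measureReal_lt_atTop {α : Type*} [MeasurableSpace α] {μ : Measure α}
    [IsFiniteMeasure μ] {u : α → ℝ} (hu : AEMeasurable u μ) :
    Tendsto (fun t : ℝ => μ.real {x | t < u x}) atTop (𝓝 0) := by
  have h := tendsto_measure_iInter_atTop (μ := μ) (s := fun t : ℝ => {x | t < u x})
    (fun t => nullMeasurableSet_lt aemeasurable_const hu)
    (fun s t hst x (hx : t < u x) => hst.trans_lt hx) ⟨0, measure_ne_top _ _⟩
  have he : ⋂ t : ℝ, {x | t < u x} = ∅ :=
    Set.eq_empty_of_forall_notMem fun x hx =>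
      lt_irrefl (u x) (Set.mem_iInter.1 hx (u x))
  rw [he, measure_empty] at h
  have h2 := (ENNReal.tendsto_toReal ENNReal.zero_ne_top).comp h
  rw [ENNReal.toReal_zero] at h2
  exact h2

/-- Replaces `m`, possibly `∞`, by a finite exponent still above `N/p`. -/
lemma exists_real_exponent {r : ℝ} (hr : 0 ≤ r) {m : ℝ≥0∞} (hm : ENNReal.ofReal r < m) :
    ∃ m' : ℝ, r < m' ∧ ENNReal.ofReal m' ≤ m := by
  obtain ⟨c, h1, h2⟩ := ENNReal.lt_iff_exists_nnreal_btwn.1 hm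
  exact ⟨c, (ENNReal.ofReal_lt_iff_lt_toReal hr ENNReal.coe_ne_top).1 h1, by simpa using h2.le⟩

theorem mainTheorem7 {N : ℕ} (hN : 2 ≤ N) (p : ℝ) (hp1 : 1 < p) (hpN : p < N)
    (Ω : Set (RN N)) (hΩo : IsOpen Ω) (hΩb : Bornology.IsBounded Ω)
    (a : RN N → ℝ → RN N → RN N) (ha : IsCaratheodory Ω a)
    (b : ℝ → ℝ) (hb_cont : Continuous b) (hb_bdd : ∃ B : ℝ, ∀ s, |b s| ≤ B)
    (ha_coer : ∀ᵐ x ∂(volume.restrict Ω), ∀ (s : ℝ) (ξ : RN N),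
      b s * ‖ξ‖ ^ p ≤ inner ℝ (a x s ξ) ξ)
    (α θ : ℝ) (hα : 0 < α) (hθ : 0 ≤ θ)
    (hb : ∀ s : ℝ, α / (1 + |s|) ^ (θ * (p - 1)) ≤ b s)
    (h : ℝ≥0 → ℝ≥0∞) (hh_cont : ContinuousOn h (Set.Ioi 0))
    (hh_fin : ∀ s : ℝ≥0, 0 < s → h s ≠ ⊤)
    (γ₂ c₂ : ℝ) (s₂ : ℝ≥0) (hγ₂ : 0 ≤ γ₂) (hc₂ : 0 < c₂) (hs₂ : 0 < s₂)
    (hh : ∀ s : ℝ≥0, s₂ ≤ s → h s ≤ ENNReal.ofReal (c₂ / (s : ℝ) ^ γ₂))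
    (hθγ : θ ≤ 1 + γ₂ / (p - 1))
    (f : RN N → ℝ) (hf_nonneg : ∀ᵐ x ∂(volume.restrict Ω), 0 ≤ f x)
    (m : ℝ≥0∞) (hm : ENNReal.ofReal (N / p) < m) (hf : MemLp f m (volume.restrict Ω))
    (u : RN N → ℝ) (hu : IsEntropySolution Ω p a h f u) :
    MemLp u ∞ (volume.restrict Ω) := by
  have : IsFiniteMeasure (volume.restrict Ω) :=
    isFiniteMeasure_restrict.2 hΩb.measure_lt_top.ne
  have hp0 : 0 < p := zero_lt_one.trans hp1
  have hN0 : (0 : ℝ) < N := hp0.trans hpN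
  have hNp : 0 < (N : ℝ) - p := sub_pos.2 hpN
  obtain ⟨m', hm', hmm⟩ := exists_real_exponent (by positivity) hm
  have hm1 : 1 < m' := ((one_lt_div hp0).2 hpN).trans hm'
  have hm0 : 0 < m' := zero_lt_one.trans hm1
  have hfm := hf.mono_exponent hmm
  have hfi : Integrable f (volume.restrict Ω) := hfm.integrable (by simpa using hm1.le)
  have hv := isGeneralizedGradient_generalizedGradient
    (exists_isGeneralizedGradient hΩo hp1 hu.measurable hu.nonneg hu.trunc_mem)
  set q : ℝ := N * p / (N - p) with hq
  have hq0 : 0 < q := by positivity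
  have hqp : q / p = N / (N - p) := by rw [hq]; field_simp
  obtain ⟨Cs, hCs⟩ := exists_sobolev_const (N := N) (by omega) (p := p.toNNReal)
    (q := q.toNNReal) (by simpa using hp1.le) (by
      rw [Real.coe_toNNReal _ hp0.le, Real.coe_toNNReal _ hq0.le, hq]
      field_simp) Ω
  set F : ℝ := (eLpNorm f (ENNReal.ofReal m') (volume.restrict Ω)).toReal
  have hF : 0 ≤ F := ENNReal.toReal_nonneg
  set C₁ : ℝ := c₂ / α * 3 ^ (θ * (p - 1))
  have hC₁ : 0 < C₁ := by positivity
  set A : ℝ → ℝ := fun t => (volume.restrict Ω).real {x | t < u x}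
  have hA0 : ∀ t, 0 ≤ A t := fun t => measureReal_nonneg
  -- The `+ 1` only makes the constant positive, since `F` may vanish.
  have hlevel : ∀ k j : ℝ, max 1 (s₂ : ℝ) ≤ k → 0 < j → j ≤ k →
      A (k + j) ≤ (Cs ^ q * (C₁ * F) ^ (q / p) + 1) * (k / j) ^ ((p - 1) * (q / p)) *
        A k ^ ((1 - 1 / m') * (q / p)) := by
    intro k j hkK hj hjk
    have hk1 : 1 ≤ k := (le_max_left _ _).trans hkK
    have hk : 0 < k := zero_lt_one.trans_le hk1
    obtain ⟨-, hGm, hlim⟩ := level_gradient hΩo hp1 hu.nonneg hu.trunc_mem hv hk hj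
    have hWm : AEStronglyMeasurable (fun x => trunc j (u x - trunc k (u x)))
        (volume.restrict Ω) := by
      refine ((hu.trunc_mem _ (add_pos hk hj)).memLp.1.sub (hu.trunc_mem _ hk).memLp.1).congr ?_
      filter_upwards [hu.nonneg] with x hx
      exact (trunc_sub_trunc hk hj hx).symm
    have h1 := measure_ge_le_of_eLpNorm_le hp0 hq0 hWm hGm (hCs _ _ hWm hGm.1 hlim) hj
    have h2 := energy_level_le hp1 hΩo ha_coer hα hθ hb hγ₂ hc₂ hh hθγ hf_nonneg hfi hu hv hk1
      ((le_max_right _ _).trans hkK) hj hjk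
    have h3 := integral_level_le hm1.le hfm {x | k < u x}
    have h4 : A (k + j) ≤
        (volume.restrict Ω).real {x | j ≤ |trunc j (u x - trunc k (u x))|} := by
      refine ENNReal.toReal_mono (measure_ne_top _ _) (measure_mono_ae ?_)
      filter_upwards [hu.nonneg] with x h0 (hx : k + j < u x)
      change j ≤ |trunc j (u x - trunc k (u x))|
      rw [trunc_of_nonneg hk h0, min_eq_right (by linarith), trunc_of_nonneg hj (by linarith),
        min_eq_right (by linarith), abs_of_pos hj]
    set I := ∫ x in Ω, ‖{x | k < u x ∧ u x ≤ k + j}.indicator (generalizedGradient Ω u) x‖ ^ p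
    change I ≤ C₁ * k ^ (p - 1) * _ at h2
    change _ ≤ F * A k ^ (1 - 1 / m') at h3
    have hI : 0 ≤ I := integral_nonneg fun x => by positivity
    have hAm : 0 ≤ A k ^ (1 - 1 / m') := Real.rpow_nonneg (hA0 k) _
    -- The factor `j` from the truncation cancels one power of `j ^ p`; what remains depends on `k`
    -- and `j` only through `k / j` and `A k`.
    have h5 : I / j ^ p ≤ C₁ * F * (k / j) ^ (p - 1) * A k ^ (1 - 1 / m') := by
      have hjp : j ^ p = j ^ (p - 1) * j := by
        rw [← Real.rpow_add_one hj.ne', sub_add_cancel]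
      rw [div_le_iff₀ (by positivity), Real.div_rpow hk.le hj.le, hjp]
      refine h2.trans ((mul_le_mul_of_nonneg_left (mul_le_mul_of_nonneg_left h3 hj.le)
        (by positivity)).trans (le_of_eq ?_))
      have : j ^ (p - 1) ≠ 0 := by positivity
      field_simp
    have hqp0 : 0 < q / p := by positivity
    calc A (k + j) ≤ Cs ^ q * (I / j ^ p) ^ (q / p) := h4.trans h1
      _ ≤ Cs ^ q * (C₁ * F * (k / j) ^ (p - 1) * A k ^ (1 - 1 / m')) ^ (q / p) := by
          gcongr
      _ = Cs ^ q * (C₁ * F) ^ (q / p) * (k / j) ^ ((p - 1) * (q / p)) *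
            A k ^ ((1 - 1 / m') * (q / p)) := by
          rw [Real.mul_rpow (by positivity) hAm, Real.mul_rpow (by positivity) (by positivity),
            ← Real.rpow_mul (by positivity), ← Real.rpow_mul (hA0 k)]
          ring
      _ ≤ _ := by
          have := Real.rpow_nonneg (hA0 k) ((1 - 1 / m') * (q / p))
          gcongr
          linarith
  -- With `N/p` in place of `m'` the product would equal `1`; the strict inequality `m' > N/p` gives
  -- the gain.
  have hβ : 1 < (1 - 1 / m') * (q / p) := by
    rw [hqp]
    have h1 : 1 / m' < p / N := by
      rw [div_lt_div_iff₀ hm0 hN0]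
      rw [div_lt_iff₀ hp0] at hm'
      linarith
    have h2 : 1 - p / N < 1 - 1 / m' := by linarith
    have h3 : (1 - p / N) * (N / (N - p)) = 1 := by field_simp
    exact h3.symm.trans_lt (mul_lt_mul_of_pos_right h2 (by positivity))
  obtain ⟨k, hk⟩ := exists_eq_zero_of_level_le hA0
    (fun s t hst => measureReal_mono fun x (hx : t < u x) => hst.trans_lt hx)
    (tendsto_measureReal_lt_atTop hu.measurable) (by positivity)
    (mul_pos (sub_pos.2 hp1) (by positivity)) hβ hlevel
  refine memLp_top_of_bound hu.measurable.aestronglyMeasurable k ?_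
  have hz : ∀ᵐ x ∂(volume.restrict Ω), ¬ k < u x := by
    rw [ae_iff]
    simpa using (measureReal_eq_zero_iff).1 hk
  filter_upwards [hz, hu.nonneg] with x h1 h2
  rw [Real.norm_eq_abs, abs_of_nonneg h2]
  exact not_lt.1 h1
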